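/- A $k$-unitrade on a set $V$ is a finite collection $U$ of $k$-element subsets of $V$ (called blocks) such that every $(k-1)$-element subset of $V$ is contained in an even number of blocks of $U$. A collection $U_2$ of subsets of $V_2$ is equivalent to a collection $U_1$ of subsets of $V_1$ if there is an injection $f:V_1\to V_2$ with $U_2=\{f(u):u\in U_1\}$. Write $abcde$ for $\{a,b,c,d,e\}$ and put $W_5=\{12345,\,23456,\,13456,\,12456,\,12356,\,12346\}$ on $\{1,\dots,6\}$, $R_5=\{23456,13456,12456,12356,12346\}\cup\{23457,13457,12457,12357,12347\}$ on $\{1,\dots,7\}$, $S=\{12356,12456,13456,23456,\;12357,12457,13457,23457,\;12367,12467,13467,23467\}$ on $\{1,\dots,7\}$, $E=\{12356,12456,13456,23456,12357,12457,13457,23457,12367,12467,13467\}\cup\{23468,23478,23678,24678,34678\}$ on $\{1,\dots,8\}$, $F=\{12357,12457,13457,23457,12367,12467,13467,23467,12368,12468,13468,23468,12358,12458,13458,23458\}$ on $\{1,\dots,8\}$. **Theorem 1.** $E=S\,\triangle\,W$ for some collection $W$ equivalent to $W_5$, and $F=S^1\,\triangle\,S^2$ for some collections $S^1,S^2$ equivalent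 to $S$. A finite collection $U$ of finite subsets of a set $V$ is a $5$-unitrade with exactly $16$ blocks if and only if at least one of the following holds: 1. $U=W\cup R$, where $W$ is equivalent to $W_5$, $R$ is equivalent to $R_5$, and $W\cap R=\emptyset$ (no common block); 2. $U$ is equivalent to $E$; 3. $U$ is equivalent to $F$. -/

import Mathlib

/-- `U` is a `k`-unitrade on `V`: a collection of `k`-subsets (blocks) of `V` such that every
`(k-1)`-subset of `V` is contained in an even number of blocks. -/
def IsUnitrade {V : Type*} [DecidableEq V] (k : ℕ) (U : Finset (Finset V)) : Prop :=
  (∀ u ∈ U, u.card = k) ∧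
    ∀ w : Finset V, w.card + 1 = k → Even (U.filter (fun u => w ⊆ u)).card

/-- The collection `f(U) = {f(u) : u ∈ U}`. -/
def relabel {V₁ V₂ : Type*} (f : V₁ ↪ V₂) (U : Finset (Finset V₁)) : Finset (Finset V₂) :=
  U.map (Finset.mapEmbedding f).toEmbedding

/-- `U₂` is equivalent to `U₁`: it is the image of `U₁` under an injection `V₁ → V₂`. -/
def EquivTo {V₁ V₂ : Type*} (U₁ : Finset (Finset V₁)) (U₂ : Finset (Finset V₂)) : Prop :=
  ∃ f : V₁ ↪ V₂, U₂ = relabel f U₁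

/-- `W_k`: all the `k`-subsets of a `(k+1)`-element set. -/
def unitradeW (k : ℕ) : Finset (Finset (Fin (k + 1))) :=
  Finset.univ.image (fun a => Finset.univ.erase a)

/-- `R_5`. Here and below the points `1, 2, 3, …` are numbered from `0`. -/
def unitradeR5 : Finset (Finset (Fin 7)) :=
  {{1, 2, 3, 4, 5}, {0, 2, 3, 4, 5}, {0, 1, 3, 4, 5}, {0, 1, 2, 4, 5},
    {0, 1, 2, 3, 5}, {1, 2, 3, 4, 6}, {0, 2, 3, 4, 6}, {0, 1, 3, 4, 6},
    {0, 1, 2, 4, 6}, {0, 1, 2, 3, 6}}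

/-- `S`. -/
def unitradeS : Finset (Finset (Fin 7)) :=
  {{0, 1, 2, 4, 5}, {0, 1, 3, 4, 5}, {0, 2, 3, 4, 5}, {1, 2, 3, 4, 5},
    {0, 1, 2, 4, 6}, {0, 1, 3, 4, 6}, {0, 2, 3, 4, 6}, {1, 2, 3, 4, 6},
    {0, 1, 2, 5, 6}, {0, 1, 3, 5, 6}, {0, 2, 3, 5, 6}, {1, 2, 3, 5, 6}}

/-- `E`. -/
def unitradeE : Finset (Finset (Fin 8)) :=
  {{0, 1, 2, 4, 5}, {0, 1, 3, 4, 5}, {0, 2, 3, 4, 5}, {1, 2, 3, 4, 5},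
    {0, 1, 2, 4, 6}, {0, 1, 3, 4, 6}, {0, 2, 3, 4, 6}, {1, 2, 3, 4, 6},
    {0, 1, 2, 5, 6}, {0, 1, 3, 5, 6}, {0, 2, 3, 5, 6}, {1, 2, 3, 5, 7},
    {1, 2, 3, 6, 7}, {1, 2, 5, 6, 7}, {1, 3, 5, 6, 7}, {2, 3, 5, 6, 7}}

/-- `F`. -/
def unitradeF : Finset (Finset (Fin 8)) :=
  {{0, 1, 2, 4, 6}, {0, 1, 3, 4, 6}, {0, 2, 3, 4, 6}, {1, 2, 3, 4, 6},
    {0, 1, 2, 5, 6}, {0, 1, 3, 5, 6}, {0, 2, 3, 5, 6}, {1, 2, 3, 5, 6},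
    {0, 1, 2, 5, 7}, {0, 1, 3, 5, 7}, {0, 2, 3, 5, 7}, {1, 2, 3, 5, 7},
    {0, 1, 2, 4, 7}, {0, 1, 3, 4, 7}, {0, 2, 3, 4, 7}, {1, 2, 3, 4, 7}}

/-!
A `k`-unitrade is a cycle modulo 2 of dimension `k - 1` in the full simplex on `V`. The sum of two
unitrades (their symmetric difference) is a unitrade, the link of a point is a `(k-1)`-unitrade,
and the simplest unitrade is the boundary `∂T` of a simplex on `k + 1` points. The method is to
find a point `v` with a small link, to fill this link by one or two simplices with apex `v`, and to
add their boundaries: this removes `v` and leaves a unitrade with fewer blocks.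

A nonempty `k`-unitrade has at least `k + 1` blocks, with equality only for `∂T`
(`IsUnitrade.card_ge_and_eq`), and otherwise at least `2 k`, with equality only for the suspensions
`∂(B ∪ {p}) △ ∂(B ∪ {q})` (`IsUnitrade.card_ge_of_ne`). For `k = 4` this says that a point of degree
at most `8` has degree `5` with link `∂A`, or degree `8` with link a suspension of `∂A`. Removing
such a point from a `5`-unitrade with `16` blocks leaves `6`, `10` or `12` blocks. Those with `6` or
`10` blocks are known by the above, those with `12` are classified by the same reduction
(`IsUnitrade.cases_of_card_eq_twelve`), and reattaching `v` gives exactly the three families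
(`IsUnitrade.isClassified_of_blockDegree_le`).

It remains to find a point of degree at most `8`. The degrees sum to `80`, which settles the case of
at least nine points, and on seven points there are at most `12` blocks
(`IsUnitrade.card_le_twelve`). On eight points, three or more of the `5`-subsets of some `6`-set `H`
are blocks; if all six are, then `∂H` splits off and a suspension is left, and otherwise one of the
two points outside `H` has small degree, by `IsUnitrade.blockDegree_add_le`.
-/

section

open Finset

variable {V : Type*} [DecidableEq V]

/-! ### Links, degrees, and sums of unitrades -/

/-- The boundary of the simplex on `T`: all sets obtained from `T` by removing one point. -/
def simplexBoundary (T : Finset V) : Finset (Finset V) := T.image T.erase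

/-- The blocks through `v`, with `v` removed. -/
def link (v : V) (U : Finset (Finset V)) : Finset (Finset V) :=
  (U.filter (v ∈ ·)).image (fun u => u.erase v)

/-- The number of blocks through `v`. -/
def blockDegree (v : V) (U : Finset (Finset V)) : ℕ := (U.filter (v ∈ ·)).card

/-- The set of the points covered by the blocks. -/
def support (U : Finset (Finset V)) : Finset V := U.biUnion id

theorem mem_support {U : Finset (Finset V)} {v : V} : v ∈ support U ↔ ∃ u ∈ U, v ∈ u := by
  simp [support]

theorem subset_support {U : Finset (Finset V)} {u : Finset V} (hu : u ∈ U) : u ⊆ support U :=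
  fun _ hx => mem_support.2 ⟨u, hu, hx⟩

theorem blockDegree_pos {U : Finset (Finset V)} {v : V} (hv : v ∈ support U) :
    0 < blockDegree v U := by
  obtain ⟨u, hu, hvu⟩ := mem_support.1 hv
  exact card_pos.2 ⟨u, by simp [hu, hvu]⟩

theorem card_link (v : V) (U : Finset (Finset V)) : (link v U).card = blockDegree v U := by
  refine card_image_of_injOn fun s hs t ht h => ?_
  rw [mem_coe, mem_filter] at hs ht
  rw [← insert_erase hs.2, ← insert_erase ht.2]
  exact congrArg (insert v) h

theorem mem_link {v : V} {U : Finset (Finset V)} {s : Finset V} :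
    s ∈ link v U ↔ v ∉ s ∧ insert v s ∈ U := by
  constructor
  · intro h
    obtain ⟨u, hu, rfl⟩ := mem_image.1 h
    rw [mem_filter] at hu
    exact ⟨notMem_erase _ _, by rw [insert_erase hu.2]; exact hu.1⟩
  · rintro ⟨h1, h2⟩
    exact mem_image.2 ⟨insert v s, by simp [h2], erase_insert h1⟩

theorem isUnitrade_link {k : ℕ} {U : Finset (Finset V)} (hU : IsUnitrade (k + 1) U) (v : V) :
    IsUnitrade k (link v U) := by
  constructor
  · intro s hs
    obtain ⟨h1, h2⟩ := mem_link.1 hs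
    have := hU.1 _ h2
    rw [card_insert_of_notMem h1] at this
    omega
  · intro w hw
    by_cases hv : v ∈ w
    · rw [filter_eq_empty_iff.2]
      · simp
      · intro s hs hws
        exact (mem_link.1 hs).1 (hws hv)
    · have h := hU.2 (insert v w) (by rw [card_insert_of_notMem hv]; omega)
      have e : (filter (fun u => insert v w ⊆ u) U).card
          = ((link v U).filter (fun s => w ⊆ s)).card := by
        symm
        refine card_bij (fun s _ => insert v s) ?_ ?_ ?_
        · intro s hs
          rw [mem_filter, mem_link] at hs
          exact mem_filter.2 ⟨hs.1.2, insert_subset_insert _ hs.2⟩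
        · intro s hs t ht hst
          rw [mem_filter, mem_link] at hs ht
          rw [← erase_insert hs.1.1, ← erase_insert ht.1.1, hst]
        · intro u hu
          rw [mem_filter] at hu
          have hvu : v ∈ u := hu.2 (mem_insert_self _ _)
          refine ⟨u.erase v, mem_filter.2 ⟨mem_link.2 ⟨notMem_erase _ _, ?_⟩, ?_⟩,
            insert_erase hvu⟩
          · rw [insert_erase hvu]; exact hu.1
          · exact fun x hx => mem_erase.2 ⟨fun h => hv (h ▸ hx), hu.2 (mem_insert_of_mem hx)⟩
      rwa [e] at h

theorem card_symmDiff_add {α : Type*} [DecidableEq α] (s t : Finset α) :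
    (symmDiff s t).card + 2 * (s ∩ t).card = s.card + t.card := by
  have h1 := card_sdiff_add_card_inter s t
  have h2 := card_sdiff_add_card_inter t s
  rw [inter_comm t s] at h2
  have h3 : (symmDiff s t).card = (s \ t).card + (t \ s).card := by
    rw [symmDiff_def, sup_eq_union, card_union_of_disjoint disjoint_sdiff_sdiff]
  omega

theorem isUnitrade_symmDiff {k : ℕ} {U X : Finset (Finset V)} (hU : IsUnitrade k U)
    (hX : IsUnitrade k X) : IsUnitrade k (symmDiff U X) := by
  constructor
  · intro u hu
    rcases mem_symmDiff.1 hu with h | h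
    exacts [hU.1 _ h.1, hX.1 _ h.1]
  · intro w hw
    have e : (symmDiff U X).filter (fun u => w ⊆ u)
        = symmDiff (U.filter (fun u => w ⊆ u)) (X.filter (fun u => w ⊆ u)) := by
      ext u
      simp only [mem_filter, mem_symmDiff]
      tauto
    have h := card_symmDiff_add (U.filter (fun u => w ⊆ u)) (X.filter (fun u => w ⊆ u))
    have h1 := hU.2 w hw
    have h2 := hX.2 w hw
    rw [e]
    rw [Nat.even_iff] at *
    omega

theorem mem_simplexBoundary {T u : Finset V} :
    u ∈ simplexBoundary T ↔ ∃ x ∈ T, T.erase x = u := mem_image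

theorem card_simplexBoundary (T : Finset V) : (simplexBoundary T).card = T.card :=
  card_image_of_injOn (erase_injOn T)

theorem isUnitrade_simplexBoundary {k : ℕ} {T : Finset V} (hT : T.card = k + 1) :
    IsUnitrade k (simplexBoundary T) := by
  constructor
  · intro u hu
    obtain ⟨x, hx, rfl⟩ := mem_simplexBoundary.1 hu
    rw [card_erase_of_mem hx]; omega
  · intro w hw
    by_cases h : w ⊆ T
    · have e : (simplexBoundary T).filter (fun u => w ⊆ u) = (T \ w).image T.erase := by
        ext u
        simp only [mem_filter, mem_simplexBoundary, mem_image, mem_sdiff]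
        constructor
        · rintro ⟨⟨x, hx, rfl⟩, hw⟩
          exact ⟨x, ⟨hx, fun hxw => notMem_erase _ _ (hw hxw)⟩, rfl⟩
        · rintro ⟨x, ⟨hx, hxw⟩, rfl⟩
          exact ⟨⟨x, hx, rfl⟩, subset_erase.2 ⟨h, hxw⟩⟩
      rw [e, card_image_of_injOn ((erase_injOn T).mono (by simp)), card_sdiff_of_subset h]
      exact ⟨1, by omega⟩
    · rw [filter_eq_empty_iff.2]
      · simp
      · intro u hu hwu
        obtain ⟨x, hx, rfl⟩ := mem_simplexBoundary.1 hu
        exact h (hwu.trans (erase_subset _ _))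

/-- The blocks of `∂(A ∪ {v})` through `v` are the cone over `∂A`. -/
theorem link_simplexBoundary_insert {A : Finset V} {v : V} (hv : v ∉ A) :
    link v (simplexBoundary (insert v A)) = simplexBoundary A := by
  ext s
  rw [mem_link, mem_simplexBoundary, mem_simplexBoundary]
  constructor
  · rintro ⟨h1, x, hx, h⟩
    have hxv : x ≠ v := by
      rintro rfl
      have : x ∈ insert x s := mem_insert_self _ _
      rw [← h] at this
      exact notMem_erase _ _ this
    refine ⟨x, mem_of_mem_insert_of_ne hx hxv, ?_⟩
    rw [← erase_insert h1, ← h, erase_right_comm, erase_insert hv]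
  · rintro ⟨x, hx, rfl⟩
    refine ⟨fun h => hv (mem_of_mem_erase h), x, mem_insert_of_mem hx, ?_⟩
    rw [erase_insert_of_ne]
    rintro rfl
    exact hv hx

theorem mem_simplexBoundary_insert {A : Finset V} {v : V} (hv : v ∉ A) :
    A ∈ simplexBoundary (insert v A) :=
  mem_simplexBoundary.2 ⟨v, mem_insert_self _ _, erase_insert hv⟩

theorem eq_of_mem_simplexBoundary_insert {A u : Finset V} {v : V} (hv : v ∉ A)
    (hu : u ∈ simplexBoundary (insert v A)) (hvu : v ∉ u) : u = A := by
  obtain ⟨x, hx, rfl⟩ := mem_simplexBoundary.1 hu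
  have : x = v := by
    by_contra h
    exact hvu (mem_erase.2 ⟨fun h' => h h'.symm, mem_insert_self _ _⟩)
  rw [this, erase_insert hv]

theorem link_symmDiff (v : V) (U X : Finset (Finset V)) :
    link v (symmDiff U X) = symmDiff (link v U) (link v X) := by
  ext s
  simp only [mem_link, mem_symmDiff]
  tauto

theorem link_eq_empty {v : V} {U : Finset (Finset V)} (h : ∀ u ∈ U, v ∉ u) : link v U = ∅ := by
  refine eq_empty_iff_forall_notMem.2 fun s hs => ?_
  exact h _ (mem_link.1 hs).2 (mem_insert_self _ _)

theorem notMem_of_link_eq_empty {v : V} {U : Finset (Finset V)} (h : link v U = ∅) :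
    ∀ u ∈ U, v ∉ u := by
  intro u hu hv
  have : u.erase v ∈ link v U := mem_link.2 ⟨notMem_erase _ _, by rwa [insert_erase hv]⟩
  rw [h] at this
  exact notMem_empty _ this

/-- Adding a family `X` with the same link at `v` cancels all the blocks through `v`, so that
the new number of blocks depends only on the common blocks that avoid `v`. -/
theorem card_symmDiff_of_link_eq {v : V} {U X : Finset (Finset V)} (h : link v U = link v X) :
    (symmDiff U X).card + 2 * blockDegree v X + 2 * ((U ∩ X).filter (v ∉ ·)).card
      = U.card + X.card := by
  have h1 := card_symmDiff_add U X
  have h2 := card_filter_add_card_filter_not (s := U ∩ X) (fun u => v ∈ u)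
  have h3 : (U ∩ X).filter (v ∈ ·) = X.filter (v ∈ ·) := by
    ext u
    simp only [mem_filter, mem_inter]
    constructor
    · tauto
    · rintro ⟨hu, hv⟩
      have : u.erase v ∈ link v X := mem_link.2 ⟨notMem_erase _ _, by rwa [insert_erase hv]⟩
      rw [← h, mem_link, insert_erase hv] at this
      exact ⟨⟨this.2, hu⟩, hv⟩
  rw [h3] at h2
  unfold blockDegree
  omega

theorem IsUnitrade.sum_blockDegree {k : ℕ} {U : Finset (Finset V)} (hU : IsUnitrade k U) :
    ∑ v ∈ support U, blockDegree v U = k * U.card := by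
  have h := sum_card_bipartiteAbove_eq_sum_card_bipartiteBelow (s := support U) (t := U)
    (fun v u => v ∈ u)
  simp only [bipartiteAbove, bipartiteBelow] at h
  unfold blockDegree
  rw [h, mul_comm, ← smul_eq_mul]
  refine sum_const_nat (m := k) fun u hu => ?_
  rw [← hU.1 u hu]
  congr 1
  ext x
  simp only [mem_filter, and_iff_right_iff_imp]
  exact fun hx => subset_support hu hx

theorem IsUnitrade.exists_blockDegree_le {k m : ℕ} {U : Finset (Finset V)} (hU : IsUnitrade k U)
    (h : k * U.card < (support U).card * (m + 1)) : ∃ v ∈ support U, blockDegree v U ≤ m := by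
  by_contra! hc
  have := card_nsmul_le_sum (support U) (fun v => blockDegree v U) (m + 1) fun v hv => hc v hv
  rw [hU.sum_blockDegree, smul_eq_mul] at this
  omega

/-! ### The smallest unitrades -/

/-- Every facet of a block lies in a second block. -/
theorem IsUnitrade.exists_neighbor {k : ℕ} {U : Finset (Finset V)} (hU : IsUnitrade k U)
    {B w : Finset V} (hB : B ∈ U) (hwB : w ⊆ B) (hw : w.card + 1 = k) :
    ∃ x, x ∉ B ∧ x ∉ w ∧ insert x w ∈ U := by
  have h := hU.2 w hw
  have hmem : B ∈ U.filter (fun u => w ⊆ u) := mem_filter.2 ⟨hB, hwB⟩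
  have h1 : 1 < (U.filter (fun u => w ⊆ u)).card := by
    have := card_pos.2 ⟨B, hmem⟩
    rw [Nat.even_iff] at h
    omega
  obtain ⟨u, hu, hne⟩ := exists_mem_ne h1 B
  rw [mem_filter] at hu
  have hcu := hU.1 u hu.1
  have hcB := hU.1 B hB
  have hc : (u \ w).card = 1 := by rw [card_sdiff_of_subset hu.2]; omega
  obtain ⟨x, hx⟩ := card_eq_one.1 hc
  have hxu : x ∈ u \ w := by simp [hx]
  rw [mem_sdiff] at hxu
  have hu' : insert x w = u := by
    rw [insert_eq, ← hx, sdiff_union_of_subset hu.2]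
  refine ⟨x, fun hxB => hne ?_, hxu.2, hu' ▸ hu.1⟩
  refine eq_of_subset_of_card_le ?_ (by omega)
  rw [← hu']
  exact insert_subset hxB hwB

/-- The least number of blocks is `k + 1`, attained only by boundaries of simplices. The blocks
adjacent to a fixed block through its `k` facets are distinct, and if there are no others then
they all use the same new point. -/
theorem IsUnitrade.card_ge_and_eq {k : ℕ} {U : Finset (Finset V)} (hU : IsUnitrade k U)
    (hne : U.Nonempty) (hk : 1 ≤ k) :
    k + 1 ≤ U.card ∧ (U.card = k + 1 → ∃ T : Finset V, T.card = k + 1 ∧ U = simplexBoundary T) := by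
  obtain ⟨B, hB⟩ := hne
  have hcB := hU.1 B hB
  have hex : ∀ b ∈ B, ∃ x, x ∉ B ∧ x ∉ B.erase b ∧ insert x (B.erase b) ∈ U := fun b hb =>
    hU.exists_neighbor hB (erase_subset _ _) (by rw [card_erase_of_mem hb]; omega)
  choose! x hxB _ hxU using hex
  set g : V → Finset V := fun b => insert (x b) (B.erase b) with hg
  have hnot : ∀ b ∈ B, b ∉ g b := by
    intro b hb h
    rcases mem_insert.1 h with h | h
    · exact hxB b hb (h ▸ hb)
    · exact notMem_erase _ _ h
  have hin : ∀ b ∈ B, ∀ c ∈ B, b ≠ c → c ∈ g b := fun b hb c hc hbc =>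
    mem_insert_of_mem (mem_erase.2 ⟨hbc.symm, hc⟩)
  have hinj : Set.InjOn g B := by
    intro b hb c hc h
    by_contra hbc
    exact hnot c hc (h ▸ hin b hb c hc hbc)
  have hBim : B ∉ B.image g := by
    intro h
    obtain ⟨b, hb, h⟩ := mem_image.1 h
    exact hnot b hb (by rw [h]; exact hb)
  have hsub : insert B (B.image g) ⊆ U :=
    insert_subset hB (image_subset_iff.2 fun b hb => hxU b hb)
  have hc : (insert B (B.image g)).card = k + 1 := by
    rw [card_insert_of_notMem hBim, card_image_of_injOn hinj, hcB]
  refine ⟨hc ▸ card_le_card hsub, fun h => ?_⟩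
  have hUe : insert B (B.image g) = U := eq_of_subset_of_card_le hsub (by omega)
  have hconst : ∀ b ∈ B, ∀ c ∈ B, x b = x c := by
    intro b hb c hc
    by_cases hbc : b = c
    · rw [hbc]
    have hw : ((g b).erase c).card + 1 = k := by
      rw [card_erase_of_mem (hin b hb c hc hbc), hU.1 _ (hxU b hb)]; omega
    -- The second block through `g b` minus `c` avoids `c` and contains `x b`, hence is `g c`.
    obtain ⟨y, hy1, hy2, hy⟩ := hU.exists_neighbor (hxU b hb) (erase_subset c _) hw
    have hyc : c ∉ insert y ((g b).erase c) := by
      rw [mem_insert, not_or]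
      exact ⟨fun h => hy1 (h ▸ hin b hb c hc hbc), notMem_erase _ _⟩
    have hxy : x b ∈ insert y ((g b).erase c) :=
      mem_insert_of_mem (mem_erase.2 ⟨fun h => hxB b hb (h ▸ hc), mem_insert_self _ _⟩)
    rw [← hUe, mem_insert, mem_image] at hy
    rcases hy with hy | ⟨d, hd, hy⟩
    · exact absurd (hy ▸ hxy) (hxB b hb)
    · rw [← hy] at hyc hxy
      have hdc : d = c := by
        by_contra hdc
        exact hyc (hin d hd c hc hdc)
      rw [hdc] at hxy
      rcases mem_insert.1 hxy with h | h
      · exact h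
      · exact absurd (mem_of_mem_erase h) (hxB b hb)
  obtain ⟨b₀, hb₀⟩ : B.Nonempty := card_pos.1 (by omega)
  refine ⟨insert (x b₀) B, by rw [card_insert_of_notMem (hxB b₀ hb₀), hcB], ?_⟩
  rw [← hUe, simplexBoundary, image_insert, erase_insert (hxB b₀ hb₀)]
  congr 1
  refine image_congr fun b hb => ?_
  have hb' : b ∈ B := hb
  have : b ≠ x b₀ := fun h => hxB b₀ hb₀ (h ▸ hb')
  simp only [hg]
  rw [hconst b hb' b₀ hb₀, erase_insert_of_ne this.symm]

/-- A unitrade that is not the boundary of a simplex covers at least `k + 2` points. -/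
theorem IsUnitrade.support_card_ge {k : ℕ} {U : Finset (Finset V)} (hU : IsUnitrade k U)
    (h : k + 1 < U.card) : k + 2 ≤ (support U).card := by
  by_contra hc
  have h1 : U ⊆ (support U).powersetCard k := fun u hu =>
    mem_powersetCard.2 ⟨subset_support hu, hU.1 u hu⟩
  have h2 := card_le_card h1
  rw [card_powersetCard] at h2
  have h3 : (support U).card.choose k ≤ (k + 1).choose k := Nat.choose_le_choose k (by omega)
  rw [Nat.choose_succ_self_right] at h3
  omega

/-- The suspension `∂(B ∪ {p}) △ ∂(B ∪ {q})` of `∂B`, where `B` is a `k`-set and `p`, `q` are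
two further points: the unitrade `R_k`. -/
def IsSuspension (k : ℕ) (U : Finset (Finset V)) : Prop :=
  ∃ (B : Finset V) (p q : V), B.card = k ∧ p ∉ B ∧ q ∉ B ∧ p ≠ q ∧
    U = symmDiff (simplexBoundary (insert p B)) (simplexBoundary (insert q B))

theorem isUnitrade_simplexBoundary_insert {k : ℕ} {A : Finset V} {v : V} (hA : A.card = k)
    (hv : v ∉ A) : IsUnitrade k (simplexBoundary (insert v A)) :=
  isUnitrade_simplexBoundary (by rw [card_insert_of_notMem hv, hA])

theorem link_simplexBoundary_of_notMem {T : Finset V} {v : V} (hv : v ∉ T) :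
    link v (simplexBoundary T) = ∅ := by
  refine link_eq_empty fun u hu h => ?_
  obtain ⟨x, _, rfl⟩ := mem_simplexBoundary.1 hu
  exact hv (mem_of_mem_erase h)

theorem notMem_of_link_simplexBoundary_eq_empty {T : Finset V} {v : V} (hT : 2 ≤ T.card)
    (h : link v (simplexBoundary T) = ∅) : v ∉ T := by
  intro hv
  obtain ⟨x, hx, hne⟩ := exists_mem_ne (by omega : 1 < T.card) v
  exact notMem_of_link_eq_empty h _ (mem_simplexBoundary.2 ⟨x, hx, rfl⟩)
    (mem_erase.2 ⟨hne.symm, hv⟩)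

/-- A `(k+1)`-set with `A` in its boundary is `A ∪ {q}`. -/
theorem exists_eq_insert_of_mem_simplexBoundary {A T : Finset V}
    (h : A ∈ simplexBoundary T) : ∃ q, q ∉ A ∧ T = insert q A := by
  obtain ⟨q, hq, rfl⟩ := mem_simplexBoundary.1 h
  exact ⟨q, notMem_erase _ _, (insert_erase hq).symm⟩

/-- At a point of the least possible degree the link is the boundary of a simplex `A`, and adding
`∂(A ∪ {v})` removes `v`. -/
theorem IsUnitrade.exists_link_eq_simplexBoundary {k : ℕ} {U : Finset (Finset V)}
    (hU : IsUnitrade (k + 1) U) (hk : 1 ≤ k) {v : V} (hv : blockDegree v U = k + 1) :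
    ∃ A : Finset V, A.card = k + 1 ∧ v ∉ A ∧ link v U = simplexBoundary A := by
  have hL := isUnitrade_link hU v
  have hc : (link v U).card = k + 1 := by rw [card_link, hv]
  obtain ⟨A, hA, hLA⟩ := (hL.card_ge_and_eq (card_pos.1 (by omega)) hk).2 hc
  refine ⟨A, hA, ?_, hLA⟩
  apply notMem_of_link_simplexBoundary_eq_empty (by omega)
  rw [← hLA]
  exact link_eq_empty fun u hu => (mem_link.1 hu).1

theorem card_symmDiff_simplexBoundary {U : Finset (Finset V)} {A : Finset V} {v : V}
    (hv : v ∉ A) (h : link v U = simplexBoundary A) :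
    (symmDiff U (simplexBoundary (insert v A))).card + A.card + (if A ∈ U then 2 else 0)
      = U.card + 1 := by
  have hl : link v U = link v (simplexBoundary (insert v A)) := by
    rw [h, link_simplexBoundary_insert hv]
  have h1 := card_symmDiff_of_link_eq hl
  have hd : blockDegree v (simplexBoundary (insert v A)) = A.card := by
    rw [← card_link, link_simplexBoundary_insert hv, card_simplexBoundary]
  have h2 : (U ∩ simplexBoundary (insert v A)).filter (v ∉ ·) = if A ∈ U then {A} else ∅ := by
    ext u
    rw [mem_filter, mem_inter]
    constructor
    · rintro ⟨⟨hu1, hu2⟩, hu3⟩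
      have := eq_of_mem_simplexBoundary_insert hv hu2 hu3
      subst this
      rw [if_pos hu1]
      exact mem_singleton_self _
    · intro hu
      split_ifs at hu with hA
      · rw [mem_singleton] at hu
        subst hu
        exact ⟨⟨hA, mem_simplexBoundary_insert hv⟩, hv⟩
      · exact absurd hu (notMem_empty _)
  rw [h2, hd, card_simplexBoundary, card_insert_of_notMem hv] at h1
  split_ifs at h1 ⊢
  · rw [card_singleton] at h1; omega
  · rw [card_empty] at h1; omega

/-- After adding `∂(A ∪ {v})` at a point `v` with link `∂A`, no block contains `v`. -/
theorem link_symmDiff_eq_empty {U X : Finset (Finset V)} {v : V} (h : link v U = link v X) :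
    link v (symmDiff U X) = ∅ := by
  rw [link_symmDiff, h, symmDiff_self]
  rfl

/-- If there are not `k + 1` blocks, there are at least `2 * k`, with equality only for suspensions.
A point of degree `k` (with `k` the uniformity) is removed by adding the boundary of a simplex. If
there is none, induction applied to the links makes all the degrees at least `2 * k - 2`, which is
too much for `2 * k` blocks on at least `k + 2` points. -/
theorem IsUnitrade.card_ge_of_ne {k : ℕ} (hk : 1 ≤ k) {U : Finset (Finset V)}
    (hU : IsUnitrade k U) (hne : U.Nonempty) (hcard : U.card ≠ k + 1) :
    2 * k ≤ U.card ∧ (U.card = 2 * k → IsSuspension k U) := by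
  induction k, hk using Nat.le_induction generalizing U with
  | base =>
    have := (hU.card_ge_and_eq hne le_rfl).1
    omega
  | succ k hk ih =>
    have hlow := (hU.card_ge_and_eq hne (by omega)).1
    by_cases hmin : ∃ v, blockDegree v U = k + 1
    · obtain ⟨v, hv⟩ := hmin
      obtain ⟨A, hA, hvA, hlink⟩ := hU.exists_link_eq_simplexBoundary hk hv
      have hc := card_symmDiff_simplexBoundary hvA hlink
      have hX : IsUnitrade (k + 1) (simplexBoundary (insert v A)) :=
        isUnitrade_simplexBoundary_insert hA hvA
      have hU' := isUnitrade_symmDiff hU hX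
      have hl : link v U = link v (simplexBoundary (insert v A)) := by
        rw [hlink, link_simplexBoundary_insert hvA]
      have hv' := link_symmDiff_eq_empty hl
      have hUe : U = symmDiff (symmDiff U (simplexBoundary (insert v A)))
        (simplexBoundary (insert v A)) := by rw [symmDiff_symmDiff_cancel_right]
      set U' := symmDiff U (simplexBoundary (insert v A)) with hU'def
      split_ifs at hc with hAU
      · have hne' : U'.Nonempty := card_pos.1 (by omega)
        have := (hU'.card_ge_and_eq hne' (by omega)).1
        omega
      · have hAU' : A ∈ U' :=
          mem_symmDiff.2 (Or.inr ⟨mem_simplexBoundary_insert hvA, hAU⟩)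
        have hge := hU'.card_ge_and_eq ⟨A, hAU'⟩ (by omega)
        refine ⟨by omega, fun h => ?_⟩
        obtain ⟨T, hT, hUT⟩ := hge.2 (by omega)
        rw [hUT] at hAU' hv'
        obtain ⟨q, hq, rfl⟩ := exists_eq_insert_of_mem_simplexBoundary hAU'
        have hvT := notMem_of_link_simplexBoundary_eq_empty (by omega) hv'
        refine ⟨A, q, v, hA, hq, hvA, fun h => hvT (h ▸ mem_insert_self _ _), ?_⟩
        rw [← hUT]
        exact hUe
    · have hdeg : ∀ v ∈ support U, k + 2 ≤ blockDegree v U ∧ 2 * k ≤ blockDegree v U := by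
        intro v hv
        have hpos : (link v U).Nonempty := by
          rw [← card_pos, card_link]; exact blockDegree_pos hv
        have h1 := ((isUnitrade_link hU v).card_ge_and_eq hpos hk).1
        have h2 : (link v U).card ≠ k + 1 := by
          rw [card_link]; exact fun h => hmin ⟨v, h⟩
        have h3 := (ih (isUnitrade_link hU v) hpos h2).1
        rw [card_link] at h1 h2 h3
        omega
      have hn := hU.support_card_ge (by omega)
      suffices h : 2 * (k + 1) < U.card by omega
      by_contra hlt
      -- For `k = 1` the bound `2 * k` on the degrees is too weak, and `k + 2` is used instead.
      obtain ⟨v, hv, hle⟩ := hU.exists_blockDegree_le (m := if k = 1 then 2 else 2 * k - 1) (by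
        split_ifs with h1
        · subst h1
          omega
        · have : 2 * k - 1 + 1 = 2 * k := by omega
          rw [this]
          calc (k + 1) * U.card ≤ (k + 1) * (2 * (k + 1)) := Nat.mul_le_mul_left _ (by omega)
            _ < (k + 3) * (2 * k) := by
              have : 2 ≤ k := by omega
              nlinarith
            _ ≤ _ := Nat.mul_le_mul_right _ (by omega))
      have := hdeg v hv
      split_ifs at hle <;> omega

/-! ### Suspensions -/

theorem subset_of_mem_simplexBoundary {T u : Finset V} (h : u ∈ simplexBoundary T) : u ⊆ T := by
  obtain ⟨x, _, rfl⟩ := mem_simplexBoundary.1 h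
  exact erase_subset _ _

theorem mem_suspension {B u : Finset V} {p q : V} (hp : p ∉ B) (hq : q ∉ B) (hpq : p ≠ q) :
    u ∈ symmDiff (simplexBoundary (insert p B)) (simplexBoundary (insert q B)) ↔
      ∃ b ∈ B, u = insert p (B.erase b) ∨ u = insert q (B.erase b) := by
  have key : ∀ p q : V, p ∉ B → q ∉ B → p ≠ q →
      ((u ∈ simplexBoundary (insert p B) ∧ u ∉ simplexBoundary (insert q B)) ↔
        ∃ b ∈ B, u = insert p (B.erase b)) := by
    intro p q hp hq hpq
    constructor
    · rintro ⟨h1, h2⟩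
      obtain ⟨x, hx, rfl⟩ := mem_simplexBoundary.1 h1
      rcases mem_insert.1 hx with rfl | hxB
      · rw [erase_insert hp] at h2
        exact absurd (mem_simplexBoundary_insert hq) h2
      · exact ⟨x, hxB, erase_insert_of_ne fun h => hp (h ▸ hxB)⟩
    · rintro ⟨b, hb, rfl⟩
      refine ⟨mem_simplexBoundary.2 ⟨b, mem_insert_of_mem hb,
        erase_insert_of_ne fun h => hp (h ▸ hb)⟩, fun h => ?_⟩
      have := subset_of_mem_simplexBoundary h (mem_insert_self _ _)
      rcases mem_insert.1 this with h | h
      · exact hpq h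
      · exact hp h
  rw [mem_symmDiff, key p q hp hq hpq, key q p hq hp hpq.symm]
  constructor
  · rintro (⟨b, hb, h⟩ | ⟨b, hb, h⟩)
    exacts [⟨b, hb, Or.inl h⟩, ⟨b, hb, Or.inr h⟩]
  · rintro ⟨b, hb, h | h⟩
    exacts [Or.inl ⟨b, hb, h⟩, Or.inr ⟨b, hb, h⟩]

theorem card_suspension {B : Finset V} {p q : V} (hp : p ∉ B) (hq : q ∉ B) (hpq : p ≠ q) :
    (symmDiff (simplexBoundary (insert p B)) (simplexBoundary (insert q B))).card
      = 2 * B.card := by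
  have h := card_symmDiff_add (simplexBoundary (insert p B)) (simplexBoundary (insert q B))
  have hi : simplexBoundary (insert p B) ∩ simplexBoundary (insert q B) = {B} := by
    ext u
    rw [mem_inter, mem_singleton]
    constructor
    · rintro ⟨h1, h2⟩
      refine eq_of_mem_simplexBoundary_insert hp h1 fun hpu => ?_
      rcases mem_insert.1 (subset_of_mem_simplexBoundary h2 hpu) with h | h
      · exact hpq h
      · exact hp h
    · rintro rfl
      exact ⟨mem_simplexBoundary_insert hp, mem_simplexBoundary_insert hq⟩
  rw [hi, card_simplexBoundary, card_simplexBoundary, card_insert_of_notMem hp,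
    card_insert_of_notMem hq, card_singleton] at h
  omega

/-- The points of a suspension are all covered by its blocks. -/
theorem notMem_of_link_suspension_eq_empty {B : Finset V} {p q v : V} (hB : 2 ≤ B.card)
    (hp : p ∉ B) (hq : q ∉ B) (hpq : p ≠ q)
    (h : link v (symmDiff (simplexBoundary (insert p B)) (simplexBoundary (insert q B))) = ∅) :
    v ∉ B ∧ v ≠ p ∧ v ≠ q := by
  have h' := notMem_of_link_eq_empty h
  obtain ⟨b, hb⟩ : B.Nonempty := card_pos.1 (by omega)
  refine ⟨fun hv => ?_, ?_, ?_⟩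
  · obtain ⟨b, hb, hbv⟩ := exists_mem_ne (by omega : 1 < B.card) v
    exact h' _ ((mem_suspension hp hq hpq).2 ⟨b, hb, Or.inl rfl⟩)
      (mem_insert_of_mem (mem_erase.2 ⟨hbv.symm, hv⟩))
  · rintro rfl
    exact h' _ ((mem_suspension hp hq hpq).2 ⟨b, hb, Or.inl rfl⟩) (mem_insert_self _ _)
  · rintro rfl
    exact h' _ ((mem_suspension hp hq hpq).2 ⟨b, hb, Or.inr rfl⟩) (mem_insert_self _ _)

theorem link_suspension_insert {A : Finset V} {p q v : V} (hv : v ∉ A) (hvp : v ≠ p)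
    (hvq : v ≠ q) :
    link v (symmDiff (simplexBoundary (insert p (insert v A)))
        (simplexBoundary (insert q (insert v A))))
      = symmDiff (simplexBoundary (insert p A)) (simplexBoundary (insert q A)) := by
  rw [link_symmDiff, insert_comm p v, insert_comm q v, link_simplexBoundary_insert,
    link_simplexBoundary_insert]
  · rw [mem_insert, not_or]; exact ⟨hvq, hv⟩
  · rw [mem_insert, not_or]; exact ⟨hvp, hv⟩

/-- If the link of `v` is the suspension of `∂A` with apices `p`, `q`, then adding the suspension
of `∂(A ∪ {v})` removes `v`; `c` counts how many of the sets `A ∪ {p}`, `A ∪ {q}` are blocks. -/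
theorem card_symmDiff_suspension {U : Finset (Finset V)} {A : Finset V} {p q v : V}
    (hp : p ∉ A) (hq : q ∉ A) (hpq : p ≠ q) (hv : v ∉ A) (hvp : v ≠ p) (hvq : v ≠ q)
    (h : link v U = symmDiff (simplexBoundary (insert p A)) (simplexBoundary (insert q A))) :
    let U' := symmDiff U (symmDiff (simplexBoundary (insert p (insert v A)))
        (simplexBoundary (insert q (insert v A))))
    ∃ c ≤ 2, U'.card + 2 * A.card + 2 * c = U.card + 2 ∧
      (c = 0 → insert p A ∈ U' ∧ insert q A ∈ U') := by
  intro U'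
  set X := symmDiff (simplexBoundary (insert p (insert v A)))
        (simplexBoundary (insert q (insert v A))) with hX
  have hpB : p ∉ insert v A := by rw [mem_insert, not_or]; exact ⟨hvp.symm, hp⟩
  have hqB : q ∉ insert v A := by rw [mem_insert, not_or]; exact ⟨hvq.symm, hq⟩
  have hlX : link v X = symmDiff (simplexBoundary (insert p A)) (simplexBoundary (insert q A)) :=
    link_suspension_insert hv hvp hvq
  have h1 := card_symmDiff_of_link_eq (h.trans hlX.symm)
  have hd : blockDegree v X = 2 * A.card := by
    rw [← card_link, hlX, card_suspension hp hq hpq]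
  have hXc : X.card = 2 * (A.card + 1) := by
    rw [hX, card_suspension hpB hqB hpq, card_insert_of_notMem hv]
  have hpX : insert p A ∈ X :=
    (mem_suspension hpB hqB hpq).2 ⟨v, mem_insert_self _ _, Or.inl (by rw [erase_insert hv])⟩
  have hqX : insert q A ∈ X :=
    (mem_suspension hpB hqB hpq).2 ⟨v, mem_insert_self _ _, Or.inr (by rw [erase_insert hv])⟩
  have hsub : (U ∩ X).filter (v ∉ ·) ⊆ {insert p A, insert q A} := by
    intro u hu
    rw [mem_filter, mem_inter] at hu
    obtain ⟨b, hb, hu'⟩ := (mem_suspension hpB hqB hpq).1 hu.1.2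
    have hbv : b = v := by
      by_contra hbv
      refine hu.2 ?_
      have : v ∈ (insert v A).erase b := mem_erase.2 ⟨fun h => hbv h.symm, mem_insert_self _ _⟩
      rcases hu' with rfl | rfl <;> exact mem_insert_of_mem this
    rw [hbv, erase_insert hv] at hu'
    rw [mem_insert, mem_singleton]
    exact hu'
  refine ⟨((U ∩ X).filter (v ∉ ·)).card, (card_le_card hsub).trans card_le_two, ?_, fun h0 => ?_⟩
  · have : U'.card = (symmDiff U X).card := rfl
    omega
  · rw [card_eq_zero] at h0
    have hnot : ∀ u ∈ X, v ∉ u → u ∉ U := fun u hu hvu huU => by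
      have : u ∈ (U ∩ X).filter (v ∉ ·) := mem_filter.2 ⟨mem_inter.2 ⟨huU, hu⟩, hvu⟩
      rw [h0] at this
      exact notMem_empty _ this
    refine ⟨mem_symmDiff.2 (Or.inr ⟨hpX, hnot _ hpX ?_⟩),
      mem_symmDiff.2 (Or.inr ⟨hqX, hnot _ hqX ?_⟩)⟩ <;> rw [mem_insert, not_or]
    exacts [⟨hvp, hv⟩, ⟨hvq, hv⟩]

/-! ### Points of small degree in unitrades with 12 or 16 blocks -/

/-- A disjoint union of the boundary of a simplex and a suspension. -/
def IsBoundaryUnionSuspension (U : Finset (Finset V)) : Prop :=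
  ∃ (T : Finset V) (R : Finset (Finset V)), T.card = 6 ∧ IsSuspension 5 R ∧
    Disjoint (simplexBoundary T) R ∧ U = simplexBoundary T ∪ R

/-- `U` is a copy of the unitrade `S`: the join of `∂Q`, `|Q| = 4`, with the boundary of the
triangle `xyz`. -/
def IsTriangleJoin (U : Finset (Finset V)) : Prop :=
  ∃ (Q : Finset V) (x y z : V), Q.card = 4 ∧ x ∉ Q ∧ y ∉ Q ∧ z ∉ Q ∧ x ≠ y ∧ x ≠ z ∧ y ≠ z ∧
    U = symmDiff (simplexBoundary (insert x (insert y Q)))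
      (symmDiff (simplexBoundary (insert x (insert z Q)))
        (simplexBoundary (insert y (insert z Q))))

/-- `U` is a copy of the unitrade `F`: the join of `∂Q`, `|Q| = 4`, with the 4-cycle whose
opposite points are `p, q` and `x, y`. -/
def IsSquareJoin (U : Finset (Finset V)) : Prop :=
  ∃ (Q : Finset V) (p q x y : V), Q.card = 4 ∧ p ∉ Q ∧ q ∉ Q ∧ x ∉ Q ∧ y ∉ Q ∧
    p ≠ q ∧ p ≠ x ∧ p ≠ y ∧ q ≠ x ∧ q ≠ y ∧ x ≠ y ∧
    U = symmDiff (symmDiff (simplexBoundary (insert p (insert x Q)))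
        (simplexBoundary (insert q (insert x Q))))
      (symmDiff (simplexBoundary (insert p (insert y Q)))
        (simplexBoundary (insert q (insert y Q))))

/-- `U` is a copy of the unitrade `E`: the join of `∂(C ∪ {c})`, `|C| = 3`, with the boundary of
the triangle `xyz`, plus the boundary of a simplex with a new apex `v` over the block
`C ∪ {x, y}`. -/
def IsStackedTriangleJoin (U : Finset (Finset V)) : Prop :=
  ∃ (C : Finset V) (c x y z v : V), C.card = 3 ∧ c ∉ C ∧ x ∉ insert c C ∧ y ∉ insert c C ∧
    z ∉ insert c C ∧ x ≠ y ∧ x ≠ z ∧ y ≠ z ∧ v ∉ insert c C ∧ v ≠ x ∧ v ≠ y ∧ v ≠ z ∧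
    U = symmDiff (symmDiff (simplexBoundary (insert x (insert y (insert c C))))
      (symmDiff (simplexBoundary (insert x (insert z (insert c C))))
        (simplexBoundary (insert y (insert z (insert c C))))))
      (simplexBoundary (insert v (insert x (insert y C))))

theorem isBoundaryUnionSuspension_of_symmDiff {U R : Finset (Finset V)} {T : Finset V}
    (hU : U.card = 16) (hT : T.card = 6) (hR : IsSuspension 5 R)
    (h : U = symmDiff (simplexBoundary T) R) : IsBoundaryUnionSuspension U := by
  have hRc : R.card = 10 := by
    obtain ⟨B, p, q, hB, hp, hq, hpq, rfl⟩ := hR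
    rw [card_suspension hp hq hpq, hB]
  have hc := card_symmDiff_add (simplexBoundary T) R
  rw [← h, hU, card_simplexBoundary, hT, hRc] at hc
  have hd : Disjoint (simplexBoundary T) R := by
    rw [disjoint_iff_inter_eq_empty, ← card_eq_zero]
    omega
  exact ⟨T, R, hT, hR, hd, by rw [h, hd.symmDiff_eq_sup, sup_eq_union]⟩

theorem IsUnitrade.isSuspension_of_card_eq_ten {U : Finset (Finset V)} (hU : IsUnitrade 5 U)
    (h : U.card = 10) : IsSuspension 5 U :=
  (hU.card_ge_of_ne (by omega) (card_pos.1 (by omega)) (by omega)).2 (by omega)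

theorem IsUnitrade.exists_eq_simplexBoundary {U : Finset (Finset V)} (hU : IsUnitrade 5 U)
    (h : U.card = 6) : ∃ T : Finset V, T.card = 6 ∧ U = simplexBoundary T :=
  (hU.card_ge_and_eq (card_pos.1 (by omega)) (by omega)).2 (by omega)

theorem IsUnitrade.card_ne_of_lt_ten {U : Finset (Finset V)} (hU : IsUnitrade 5 U)
    (h : U.card < 10) : U.card = 0 ∨ U.card = 6 := by
  by_contra! hc
  have := (hU.card_ge_of_ne (by omega) (card_pos.1 (by omega)) (by omega)).1
  omega

/-- A link with at most `8` blocks is the boundary of a simplex or a suspension, since a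
`4`-unitrade has `5` or at least `8` blocks. -/
theorem IsUnitrade.link_cases {U : Finset (Finset V)} (hU : IsUnitrade 5 U) {v : V}
    (hv : v ∈ support U) (hle : blockDegree v U ≤ 8) :
    (∃ A : Finset V, A.card = 5 ∧ v ∉ A ∧ link v U = simplexBoundary A) ∨
    ∃ (A : Finset V) (p q : V), A.card = 4 ∧ p ∉ A ∧ q ∉ A ∧ p ≠ q ∧ v ∉ A ∧ v ≠ p ∧ v ≠ q ∧
      link v U = symmDiff (simplexBoundary (insert p A)) (simplexBoundary (insert q A)) := by
  by_cases h5 : blockDegree v U = 5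
  · exact Or.inl (hU.exists_link_eq_simplexBoundary (k := 4) (by omega) h5)
  · right
    have hL : IsUnitrade 4 (link v U) := isUnitrade_link hU v
    have hpos := blockDegree_pos hv
    rw [← card_link] at hle h5 hpos
    have h8 := hL.card_ge_of_ne (by omega) (card_pos.1 hpos) h5
    obtain ⟨A, p, q, hA, hp, hq, hpq, hl⟩ := h8.2 (by omega)
    have he : link v (link v U) = ∅ := link_eq_empty fun u hu => (mem_link.1 hu).1
    rw [hl] at he
    obtain ⟨h1, h2, h3⟩ := notMem_of_link_suspension_eq_empty (by omega) hp hq hpq he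
    exact ⟨A, p, q, hA, hp, hq, hpq, h1, h2, h3, hl⟩

theorem isUnitrade_suspension {k : ℕ} {B : Finset V} {p q : V} (hB : B.card = k)
    (hp : p ∉ B) (hq : q ∉ B) :
    IsUnitrade k (symmDiff (simplexBoundary (insert p B)) (simplexBoundary (insert q B))) :=
  isUnitrade_symmDiff (isUnitrade_simplexBoundary_insert hB hp)
    (isUnitrade_simplexBoundary_insert hB hq)

/-- There are at least `7` points, so some degree is at most `60 / 7 < 9`. Removing such a point
leaves the boundary of a simplex. -/
theorem IsUnitrade.cases_of_card_eq_twelve {U : Finset (Finset V)} (hU : IsUnitrade 5 U)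
    (h : U.card = 12) : IsTriangleJoin U ∨ ∃ T T' : Finset V, T.card = 6 ∧ T'.card = 6 ∧
      Disjoint (simplexBoundary T) (simplexBoundary T') ∧
      U = symmDiff (simplexBoundary T) (simplexBoundary T') := by
  have hn := hU.support_card_ge (by omega)
  obtain ⟨v, hv, hle⟩ := hU.exists_blockDegree_le (m := 8) (by omega)
  rcases hU.link_cases hv hle with ⟨A, hA, hvA, hl⟩ |
    ⟨A, p, q, hA, hp, hq, hpq, hvA, hvp, hvq, hl⟩
  · right
    have hX := isUnitrade_simplexBoundary_insert hA hvA
    have hU' := isUnitrade_symmDiff hU hX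
    have hc := card_symmDiff_simplexBoundary hvA hl
    have h6 : (symmDiff U (simplexBoundary (insert v A))).card = 6 := by
      have := hU'.card_ne_of_lt_ten
      split_ifs at hc <;> omega
    obtain ⟨T, hT, hUT⟩ := hU'.exists_eq_simplexBoundary h6
    have hUe : U = symmDiff (simplexBoundary T) (simplexBoundary (insert v A)) := by
      rw [← hUT, symmDiff_symmDiff_cancel_right]
    have hA' : (insert v A).card = 6 := by rw [card_insert_of_notMem hvA, hA]
    refine ⟨T, insert v A, hT, hA', ?_, hUe⟩
    have h1 := card_symmDiff_add (simplexBoundary T) (simplexBoundary (insert v A))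
    rw [← hUe, card_simplexBoundary, card_simplexBoundary] at h1
    rw [disjoint_iff_inter_eq_empty, ← card_eq_zero]
    omega
  · left
    have hB : (insert v A).card = 5 := by rw [card_insert_of_notMem hvA, hA]
    have hX := isUnitrade_suspension (p := p) (q := q) hB
      (by rw [mem_insert, not_or]; exact ⟨hvp.symm, hp⟩)
      (by rw [mem_insert, not_or]; exact ⟨hvq.symm, hq⟩)
    have hU' := isUnitrade_symmDiff hU hX
    obtain ⟨c, hc2, hc, hc0⟩ := card_symmDiff_suspension hp hq hpq hvA hvp hvq hl
    have h6 := hU'.card_ne_of_lt_ten (by omega)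
    obtain ⟨hpU, hqU⟩ := hc0 (by omega)
    obtain ⟨T, hT, hUT⟩ := hU'.exists_eq_simplexBoundary (by omega)
    rw [hUT] at hpU hqU
    have hpq' : q ∉ insert p A := by rw [mem_insert, not_or]; exact ⟨hpq.symm, hq⟩
    have hTe : insert q (insert p A) = T := by
      refine eq_of_subset_of_card_le (insert_subset ?_ (subset_of_mem_simplexBoundary hpU)) ?_
      · exact subset_of_mem_simplexBoundary hqU (mem_insert_self _ _)
      · rw [card_insert_of_notMem hpq', card_insert_of_notMem hp]; omega
    refine ⟨A, p, q, v, hA, hp, hq, hvA, hpq, hvp.symm, hvq.symm, ?_⟩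
    rw [insert_comm p q, hTe, ← hUT, symmDiff_symmDiff_cancel_right]

/-- Stacking a new simplex on a block of the join of `∂Q` with a triangle gives `E`. -/
theorem IsTriangleJoin.stack {U : Finset (Finset V)} (hU : IsTriangleJoin U) {A : Finset V}
    {v : V} (hA : A ∈ U) (hv : ∀ u ∈ U, v ∉ u) :
    IsStackedTriangleJoin (symmDiff U (simplexBoundary (insert v A))) := by
  -- By symmetry the block may be taken in the simplex that omits `z`.
  have key : ∀ (Q : Finset V) (x y z : V), Q.card = 4 → x ∉ Q → y ∉ Q → z ∉ Q → x ≠ y → x ≠ z →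
      y ≠ z → U = symmDiff (simplexBoundary (insert x (insert y Q)))
        (symmDiff (simplexBoundary (insert x (insert z Q)))
        (simplexBoundary (insert y (insert z Q)))) →
      A ∈ simplexBoundary (insert x (insert y Q)) →
      IsStackedTriangleJoin (symmDiff U (simplexBoundary (insert v A))) := by
    intro Q x y z hQ hx hy hz hxy hxz hyz hUe hAm
    obtain ⟨c, hc, hcA⟩ := mem_simplexBoundary.1 hAm
    have hxQ : insert x Q ∉ U := by
      rw [hUe]
      have h1 : insert x Q ∈ simplexBoundary (insert x (insert y Q)) :=
        mem_simplexBoundary.2 ⟨y, by simp, by grind⟩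
      have h2 : insert x Q ∈ simplexBoundary (insert x (insert z Q)) :=
        mem_simplexBoundary.2 ⟨z, by simp, by grind⟩
      have h3 : insert x Q ∉ simplexBoundary (insert y (insert z Q)) := fun h => by
        have := subset_of_mem_simplexBoundary h (mem_insert_self _ _)
        grind
      simp only [mem_symmDiff]
      tauto
    have hyQ : insert y Q ∉ U := by
      rw [hUe]
      have h1 : insert y Q ∈ simplexBoundary (insert x (insert y Q)) :=
        mem_simplexBoundary.2 ⟨x, by simp, by grind⟩
      have h2 : insert y Q ∈ simplexBoundary (insert y (insert z Q)) :=
        mem_simplexBoundary.2 ⟨z, by simp, by grind⟩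
      have h3 : insert y Q ∉ simplexBoundary (insert x (insert z Q)) := fun h => by
        have := subset_of_mem_simplexBoundary h (mem_insert_self _ _)
        grind
      simp only [mem_symmDiff]
      tauto
    have hcx : c ≠ x := by
      rintro rfl
      rw [erase_insert (by grind)] at hcA
      exact hyQ (hcA ▸ hA)
    have hcy : c ≠ y := by
      rintro rfl
      rw [insert_comm, erase_insert (by grind)] at hcA
      exact hxQ (hcA ▸ hA)
    have hcQ : c ∈ Q := by grind
    have hAe : A = insert x (insert y (Q.erase c)) := by grind
    have hblock : ∀ {d s t : V}, s = x ∧ t = y ∨ s = x ∧ t = z ∨ s = y ∧ t = z → d ∈ Q →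
        insert s (insert t (Q.erase d)) ∈ U := by
      intro d s t hst hd
      rw [hUe]
      have h1 : insert s (insert t (Q.erase d)) ∈ simplexBoundary (insert s (insert t Q)) :=
        mem_simplexBoundary.2 ⟨d, by simp [hd], by grind⟩
      have h2 : ∀ {r : Finset V}, s ∉ r ∨ t ∉ r →
          insert s (insert t (Q.erase d)) ∉ simplexBoundary r := fun hr h => by
        have h3 := subset_of_mem_simplexBoundary h
        rcases hr with hr | hr
        · exact hr (h3 (mem_insert_self _ _))
        · exact hr (h3 (mem_insert_of_mem (mem_insert_self _ _)))
      simp only [mem_symmDiff]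
      rcases hst with ⟨rfl, rfl⟩ | ⟨rfl, rfl⟩ | ⟨rfl, rfl⟩
      · have h3 := h2 (r := insert s (insert z Q)) (by grind)
        have h4 := h2 (r := insert t (insert z Q)) (by grind)
        tauto
      · have h3 := h2 (r := insert s (insert y Q)) (by grind)
        have h4 := h2 (r := insert y (insert t Q)) (by grind)
        tauto
      · have h3 := h2 (r := insert x (insert s Q)) (by grind)
        have h4 := h2 (r := insert x (insert t Q)) (by grind)
        tauto
    have hxz' := hv _ (hblock (d := c) (Or.inr (Or.inl ⟨rfl, rfl⟩)) hcQ)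
    have hxy' := hv _ (hblock (d := c) (Or.inl ⟨rfl, rfl⟩) hcQ)
    obtain ⟨d, hd, hdc⟩ := exists_mem_ne (by omega : 1 < Q.card) c
    have hxd' := hv _ (hblock (d := d) (Or.inl ⟨rfl, rfl⟩) hd)
    refine ⟨Q.erase c, c, x, y, z, v, by rw [card_erase_of_mem hcQ, hQ], notMem_erase _ _, ?_⟩
    rw [insert_erase hcQ, ← hUe, ← hAe]
    refine ⟨hx, hy, hz, hxy, hxz, hyz, ?_, ?_, ?_, ?_, rfl⟩ <;> grind
  obtain ⟨Q, x, y, z, hQ, hx, hy, hz, hxy, hxz, hyz, hUe⟩ := hU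
  have hmem : A ∈ simplexBoundary (insert x (insert y Q)) ∨
      A ∈ simplexBoundary (insert x (insert z Q)) ∨
      A ∈ simplexBoundary (insert y (insert z Q)) := by
    rw [hUe] at hA
    simp only [mem_symmDiff] at hA
    tauto
  rcases hmem with h | h | h
  · exact key Q x y z hQ hx hy hz hxy hxz hyz hUe h
  · refine key Q x z y hQ hx hz hy hxz hxy hyz.symm ?_ h
    rw [hUe, insert_comm y z, ← symmDiff_assoc, ← symmDiff_assoc]
    congr 1
    exact symmDiff_comm _ _
  · refine key Q y z x hQ hy hz hx hyz hxy.symm hxz.symm ?_ h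
    rw [hUe, ← symmDiff_assoc, symmDiff_comm, insert_comm x y, insert_comm x z]

/-- The three families of the classification. -/
def IsClassified (U : Finset (Finset V)) : Prop :=
  IsBoundaryUnionSuspension U ∨ IsStackedTriangleJoin U ∨ IsSquareJoin U

/-- Removing a point of degree `5` leaves a suspension or a unitrade with `12` blocks. -/
theorem IsUnitrade.isClassified_of_link_eq_simplexBoundary {U : Finset (Finset V)}
    (hU : IsUnitrade 5 U) (h : U.card = 16) {A : Finset V} {v : V} (hA : A.card = 5)
    (hvA : v ∉ A) (hl : link v U = simplexBoundary A) : IsClassified U := by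
  have hX := isUnitrade_simplexBoundary_insert hA hvA
  have hU' := isUnitrade_symmDiff hU hX
  have hc := card_symmDiff_simplexBoundary hvA hl
  have hA6 : (insert v A).card = 6 := by rw [card_insert_of_notMem hvA, hA]
  have hv' : link v (symmDiff U (simplexBoundary (insert v A))) = ∅ :=
    link_symmDiff_eq_empty (by rw [hl, link_simplexBoundary_insert hvA])
  have hUe : U = symmDiff (symmDiff U (simplexBoundary (insert v A)))
    (simplexBoundary (insert v A)) := by rw [symmDiff_symmDiff_cancel_right]
  set U' := symmDiff U (simplexBoundary (insert v A)) with hU'def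
  split_ifs at hc with hAU
  · refine Or.inl (isBoundaryUnionSuspension_of_symmDiff h hA6
      (hU'.isSuspension_of_card_eq_ten (by omega)) ?_)
    rw [symmDiff_comm]
    exact hUe
  · have hAU' : A ∈ U' := mem_symmDiff.2 (Or.inr ⟨mem_simplexBoundary_insert hvA, hAU⟩)
    have hvU' := notMem_of_link_eq_empty hv'
    rcases hU'.cases_of_card_eq_twelve (by omega) with hS | ⟨T, T', hT, hT', hd, hTT⟩
    · rw [hUe]
      exact Or.inr (Or.inl (hS.stack hAU' hvU'))
    · have key : ∀ T T' : Finset V, T.card = 6 → T'.card = 6 →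
          Disjoint (simplexBoundary T) (simplexBoundary T') →
          U' = symmDiff (simplexBoundary T) (simplexBoundary T') → A ∈ simplexBoundary T →
          IsClassified U := by
        intro T T' hT hT' hd hTT hAT
        obtain ⟨q, hq, rfl⟩ := exists_eq_insert_of_mem_simplexBoundary hAT
        have hvT : v ∉ insert q A := by
          refine notMem_of_link_simplexBoundary_eq_empty (by omega) (link_eq_empty fun u hu => ?_)
          refine hvU' u ?_
          rw [hTT, hd.symmDiff_eq_sup]
          exact mem_union_left _ hu
        refine Or.inl (isBoundaryUnionSuspension_of_symmDiff h hT'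
          ⟨A, q, v, hA, hq, hvA, fun h => hvT (h ▸ mem_insert_self _ _), rfl⟩ ?_)
        rw [← symmDiff_assoc, symmDiff_comm (simplexBoundary T'), ← hTT]
        exact hUe
      have hm := hAU'
      rw [hTT, mem_symmDiff] at hm
      rcases hm with hm | hm
      · exact key T T' hT hT' hd hTT hm.1
      · exact key T' T hT' hT hd.symm (hTT.trans (symmDiff_comm _ _)) hm.1

/-- An apex of a suspension lies in the blocks of one cone only, so that its link is the
boundary of the base. -/
theorem link_suspension_right {B : Finset V} {p q : V} (hq : q ∉ B) (hpq : p ≠ q) :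
    link q (symmDiff (simplexBoundary (insert p B)) (simplexBoundary (insert q B)))
      = simplexBoundary B := by
  rw [link_symmDiff, link_simplexBoundary_insert hq, link_simplexBoundary_of_notMem]
  · exact bot_symmDiff _
  · rw [mem_insert, not_or]
    exact ⟨hpq.symm, hq⟩

/-- Removing a point whose link is a suspension leaves the boundary of a simplex or another
suspension, and in the latter case the two suspensions share two blocks `A ∪ {p}`, `A ∪ {q}`. -/
theorem IsUnitrade.isClassified_of_blockDegree_le {U : Finset (Finset V)} (hU : IsUnitrade 5 U)
    (h : U.card = 16) {v : V} (hv : v ∈ support U) (hle : blockDegree v U ≤ 8) :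
    IsClassified U := by
  rcases hU.link_cases hv hle with ⟨A, hA, hvA, hl⟩ |
    ⟨A, p, q, hA, hp, hq, hpq, hvA, hvp, hvq, hl⟩
  · exact hU.isClassified_of_link_eq_simplexBoundary h hA hvA hl
  have hB : (insert v A).card = 5 := by rw [card_insert_of_notMem hvA, hA]
  have hpB : p ∉ insert v A := by rw [mem_insert, not_or]; exact ⟨hvp.symm, hp⟩
  have hqB : q ∉ insert v A := by rw [mem_insert, not_or]; exact ⟨hvq.symm, hq⟩
  have hX := isUnitrade_suspension hB hpB hqB
  have hU' := isUnitrade_symmDiff hU hX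
  obtain ⟨c, hc2, hc, hc0⟩ := card_symmDiff_suspension hp hq hpq hvA hvp hvq hl
  have hv' : link v (symmDiff U (symmDiff (simplexBoundary (insert p (insert v A)))
      (simplexBoundary (insert q (insert v A))))) = ∅ :=
    link_symmDiff_eq_empty (by rw [hl, link_suspension_insert hvA hvp hvq])
  set X := symmDiff (simplexBoundary (insert p (insert v A)))
    (simplexBoundary (insert q (insert v A))) with hXdef
  have hUe : U = symmDiff (symmDiff U X) X := by rw [symmDiff_symmDiff_cancel_right]
  set U' := symmDiff U X with hU'def
  have hcard := hU'.card_ne_of_lt_ten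
  by_cases h6 : U'.card = 6
  · obtain ⟨T, hT, hUT⟩ := hU'.exists_eq_simplexBoundary h6
    refine Or.inl (isBoundaryUnionSuspension_of_symmDiff h hT
      ⟨insert v A, p, q, hB, hpB, hqB, hpq, rfl⟩ ?_)
    rw [← hUT]
    exact hUe
  obtain ⟨hpU, hqU⟩ := hc0 (by omega)
  obtain ⟨B, s, t, hBc, hs, ht, hst, hR⟩ := hU'.isSuspension_of_card_eq_ten (by omega)
  -- If one apex `s` lies in both `A ∪ {p}` and `A ∪ {q}`, then the other apex keeps its link.
  have same : ∀ s t : V, s ∉ B → t ∉ B → s ≠ t →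
      U' = symmDiff (simplexBoundary (insert s B)) (simplexBoundary (insert t B)) →
      (∃ b ∈ B, insert p A = insert s (B.erase b)) →
      (∃ b ∈ B, insert q A = insert s (B.erase b)) → IsClassified U := by
    rintro s t hs ht hst hR ⟨b, hb, hpb⟩ ⟨b', hb', hqb⟩
    rw [hR] at hv'
    obtain ⟨_, _, hvt⟩ := notMem_of_link_suspension_eq_empty (by omega) hs ht hst hv'
    have htp : t ∉ insert p A := by rw [hpb]; grind
    have htq : t ∉ insert q A := by rw [hqb]; grind
    refine hU.isClassified_of_link_eq_simplexBoundary h hBc ht ?_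
    rw [hUe, link_symmDiff, hR, link_suspension_right ht hst, hXdef, link_symmDiff,
      link_simplexBoundary_of_notMem, link_simplexBoundary_of_notMem]
    · simp
    · grind
    · grind
  -- If the apices are separated, they are `p` and `q`, and the two suspensions form a square.
  have diff : ∀ s t : V, s ∉ B → t ∉ B → s ≠ t →
      U' = symmDiff (simplexBoundary (insert s B)) (simplexBoundary (insert t B)) →
      (∃ b ∈ B, insert p A = insert s (B.erase b)) →
      (∃ b ∈ B, insert q A = insert t (B.erase b)) → IsClassified U := by
    rintro s t hs ht hst hR ⟨b, hb, hpb⟩ ⟨b', hb', hqb⟩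
    rw [hR] at hv'
    obtain ⟨hvB, _, _⟩ := notMem_of_link_suspension_eq_empty (by omega) hs ht hst hv'
    have hsp : s ∈ insert p A := hpb ▸ mem_insert_self _ _
    have hsq : s ∉ insert q A := by rw [hqb]; grind
    have htq : t ∈ insert q A := hqb ▸ mem_insert_self _ _
    have htp : t ∉ insert p A := by rw [hpb]; grind
    obtain rfl : s = p := by grind
    obtain rfl : t = q := by grind
    have hAB : A = B.erase b := by
      rw [← erase_insert hp, hpb, erase_insert (fun h => hs (mem_of_mem_erase h))]
    have hBe : B = insert b A := by rw [hAB, insert_erase hb]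
    subst hBe
    refine Or.inr (Or.inr ⟨A, s, t, b, v, hA, hp, hq, ?_, hvA, hpq, ?_, hvp.symm, ?_, hvq.symm,
      ?_, ?_⟩)
    · rw [hAB]; exact notMem_erase _ _
    · rintro rfl; exact hs hb
    · rintro rfl; exact ht hb
    · rintro rfl; exact hvB hb
    · rw [← hR, ← hXdef]
      exact hUe
  rw [hR] at hpU hqU
  obtain ⟨b, hb, hpb⟩ := (mem_suspension hs ht hst).1 hpU
  obtain ⟨b', hb', hqb⟩ := (mem_suspension hs ht hst).1 hqU
  have hR' := hR.trans (symmDiff_comm _ _)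
  rcases hpb with hpb | hpb <;> rcases hqb with hqb | hqb
  · exact same s t hs ht hst hR ⟨b, hb, hpb⟩ ⟨b', hb', hqb⟩
  · exact diff s t hs ht hst hR ⟨b, hb, hpb⟩ ⟨b', hb', hqb⟩
  · exact diff t s ht hs hst.symm hR' ⟨b, hb, hpb⟩ ⟨b', hb', hqb⟩
  · exact same t s ht hs hst.symm hR' ⟨b, hb, hpb⟩ ⟨b', hb', hqb⟩

/-! ### Existence of a point of small degree -/

theorem support_link_subset (v : V) (U : Finset (Finset V)) :
    support (link v U) ⊆ (support U).erase v := by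
  intro x hx
  obtain ⟨s, hs, hxs⟩ := mem_support.1 hx
  obtain ⟨h1, h2⟩ := mem_link.1 hs
  exact mem_erase.2 ⟨fun h => h1 (h ▸ hxs), mem_support.2 ⟨_, h2, mem_insert_of_mem hxs⟩⟩

/-- A bound for `k`-unitrades on `n` points gives one for `(k+1)`-unitrades on `n+1` points, by
summing over the links. -/
theorem card_le_of_link_card_le {k n m : ℕ}
    (h : ∀ L : Finset (Finset V), IsUnitrade k L → (support L).card ≤ n → L.card ≤ m)
    {U : Finset (Finset V)} (hU : IsUnitrade (k + 1) U) (hn : (support U).card ≤ n + 1) :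
    (k + 1) * U.card ≤ (n + 1) * m := by
  rw [← hU.sum_blockDegree]
  refine (sum_le_card_nsmul _ _ m fun v hv => ?_).trans ?_
  · rw [← card_link]
    refine h _ (isUnitrade_link hU v) ?_
    have := card_le_card (support_link_subset v U)
    rw [card_erase_of_mem hv] at this
    omega
  · rw [smul_eq_mul]
    exact Nat.mul_le_mul_right _ hn

/-- On `k + 2` points a `k`-unitrade has at most `⌊(k+2)²/4⌋` blocks; here `k = 5`. -/
theorem IsUnitrade.card_le_twelve {U : Finset (Finset V)} (hU : IsUnitrade 5 U)
    (hn : (support U).card ≤ 7) : U.card ≤ 12 := by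
  have h1 : ∀ L : Finset (Finset V), IsUnitrade 1 L → (support L).card ≤ 3 → L.card ≤ 2 := by
    intro L hL h
    have h0 : ∀ M : Finset (Finset V), IsUnitrade 0 M → (support M).card ≤ 2 → M.card ≤ 1 := by
      refine fun M hM _ => card_le_one.2 fun a ha b hb => ?_
      rw [card_eq_zero.1 (hM.1 a ha), card_eq_zero.1 (hM.1 b hb)]
    have h3 := card_le_of_link_card_le h0 hL h
    have he := hL.2 ∅ (by simp)
    simp only [empty_subset, filter_true, Nat.even_iff] at he
    omega
  have h2 : ∀ L : Finset (Finset V), IsUnitrade 2 L → (support L).card ≤ 4 → L.card ≤ 4 := by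
    intro L hL h
    have := card_le_of_link_card_le h1 hL h
    omega
  have h3 : ∀ L : Finset (Finset V), IsUnitrade 3 L → (support L).card ≤ 5 → L.card ≤ 6 := by
    intro L hL h
    have := card_le_of_link_card_le h2 hL h
    omega
  have h4 : ∀ L : Finset (Finset V), IsUnitrade 4 L → (support L).card ≤ 6 → L.card ≤ 9 := by
    intro L hL h
    have := card_le_of_link_card_le h3 hL h
    omega
  have := card_le_of_link_card_le h4 hU hn
  omega

theorem IsUnitrade.isClassified_of_simplexBoundary_subset {U : Finset (Finset V)}
    (hU : IsUnitrade 5 U) (h : U.card = 16) {H : Finset V} (hH : H.card = 6)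
    (hsub : simplexBoundary H ⊆ U) : IsClassified U := by
  have hU' := isUnitrade_symmDiff hU (isUnitrade_simplexBoundary hH)
  have hc := card_symmDiff_add U (simplexBoundary H)
  rw [inter_eq_right.2 hsub, card_simplexBoundary] at hc
  refine Or.inl (isBoundaryUnionSuspension_of_symmDiff h hH
    (hU'.isSuspension_of_card_eq_ten (by omega)) ?_)
  rw [symmDiff_comm, symmDiff_symmDiff_cancel_right]

/-- Lower bound for the number of blocks missing a point `v ∉ H`: these are the blocks inside `H`
and the blocks `H ∖ {y, z} ∪ {x}`, of which only those with `H ∖ {y}` a block and `H ∖ {z}` not a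
block are counted. -/
theorem card_missing_ge {U : Finset (Finset V)} {H : Finset V} {v x : V} (hv : v ∉ H)
    (hx : x ∉ H) (hvx : v ≠ x) :
    (H.filter (H.erase · ∈ U)).card +
      ((H.filter (H.erase · ∈ U) ×ˢ H.filter (H.erase · ∉ U)).filter
        (fun a => insert x ((H.erase a.1).erase a.2) ∈ U)).card + blockDegree v U ≤ U.card := by
  set N := H.filter (H.erase · ∈ U) with hN
  set M := H.filter (H.erase · ∉ U) with hM
  set P := (N ×ˢ M).filter (fun a => insert x ((H.erase a.1).erase a.2) ∈ U) with hP
  have h1 : (N.image H.erase).card = N.card :=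
    card_image_of_injOn ((erase_injOn H).mono (by rw [hN]; exact coe_subset.2 (filter_subset _ _)))
  have h2 : (P.image (fun a => insert x ((H.erase a.1).erase a.2))).card = P.card := by
    refine card_image_of_injOn ?_
    rintro ⟨y, z⟩ h ⟨y', z'⟩ h' he
    rw [mem_coe, hP, mem_filter, mem_product, hN, hM, mem_filter, mem_filter] at h h'
    dsimp only at h h' he
    have hy : y ∉ insert x ((H.erase y').erase z') := by rw [← he]; grind
    have hz : z ∉ insert x ((H.erase y').erase z') := by rw [← he]; grind
    have hy' : y = y' ∨ y = z' := by grind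
    have hz' : z = y' ∨ z = z' := by grind
    rcases hy' with rfl | rfl
    · rcases hz' with rfl | rfl
      · exact absurd h.1.1.2 h.1.2.2
      · rfl
    · exact absurd h.1.1.2 h'.1.2.2
  have hd : Disjoint (N.image H.erase)
      (P.image (fun a => insert x ((H.erase a.1).erase a.2))) := by
    rw [disjoint_left]
    intro u hu hu'
    obtain ⟨y, _, rfl⟩ := mem_image.1 hu
    obtain ⟨a, _, he⟩ := mem_image.1 hu'
    have : x ∈ H.erase y := he ▸ mem_insert_self _ _
    exact hx (mem_of_mem_erase this)
  have hsub : N.image H.erase ∪ P.image (fun a => insert x ((H.erase a.1).erase a.2))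
      ⊆ U.filter (v ∉ ·) := by
    refine union_subset (image_subset_iff.2 fun y hy => ?_) (image_subset_iff.2 fun a ha => ?_)
    · exact mem_filter.2 ⟨(mem_filter.1 hy).2, fun h => hv (mem_of_mem_erase h)⟩
    · refine mem_filter.2 ⟨(mem_filter.1 ha).2, fun h => ?_⟩
      rcases mem_insert.1 h with h | h
      · exact hvx h
      · exact hv (mem_of_mem_erase (mem_of_mem_erase h))
  have hle := card_le_card hsub
  rw [card_union_of_disjoint hd, h1, h2] at hle
  have := card_filter_add_card_filter_not (s := U) (fun u => v ∈ u)
  unfold blockDegree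
  omega

/-- Let `H ∪ {v, x}` carry `U`, with `|H| = 6`, and let `d` of the `5`-subsets of `H` be blocks.
For `H ∖ {y}` a block and `H ∖ {z}` not, `H ∖ {y, z}` together with `v` or `x` is a block, so at
least `2 d + d (6 - d)` blocks miss `v` or `x`, counted with multiplicity. -/
theorem IsUnitrade.blockDegree_add_le {U : Finset (Finset V)} (hU : IsUnitrade 5 U)
    {H : Finset V} {v x : V} (hH : H.card = 6) (hv : v ∉ H) (hx : x ∉ H) (hvx : v ≠ x)
    (hsupp : support U ⊆ insert v (insert x H)) :
    blockDegree v U + blockDegree x U + (2 * (H.filter (H.erase · ∈ U)).card +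
      (H.filter (H.erase · ∈ U)).card * (H.filter (H.erase · ∉ U)).card) ≤ 2 * U.card := by
  have h1 := card_missing_ge (U := U) hv hx hvx
  have h2 := card_missing_ge (U := U) hx hv hvx.symm
  set N := H.filter (H.erase · ∈ U) with hN
  set M := H.filter (H.erase · ∉ U) with hM
  have hcover : N ×ˢ M ⊆ (N ×ˢ M).filter (fun a => insert x ((H.erase a.1).erase a.2) ∈ U) ∪
      (N ×ˢ M).filter (fun a => insert v ((H.erase a.1).erase a.2) ∈ U) := by
    rintro ⟨y, z⟩ ha
    rw [← filter_or, mem_filter]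
    refine ⟨ha, ?_⟩
    rw [mem_product, hN, hM, mem_filter, mem_filter] at ha
    dsimp only at ha ⊢
    have hzy : z ≠ y := by
      rintro rfl
      exact ha.2.2 ha.1.2
    have hz : z ∈ H.erase y := mem_erase.2 ⟨hzy, ha.2.1⟩
    obtain ⟨t, ht1, ht2, ht⟩ := hU.exists_neighbor ha.1.2 (erase_subset z (H.erase y))
      (by rw [card_erase_of_mem hz, card_erase_of_mem ha.1.1]; omega)
    have htT := hsupp (subset_support ht (mem_insert_self _ _))
    rw [mem_insert, mem_insert] at htT
    rcases htT with rfl | rfl | htH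
    · exact Or.inr ht
    · exact Or.inl ht
    · have hty : t = y := by grind
      have : insert t ((H.erase y).erase z) = H.erase z := by grind
      rw [this] at ht
      exact absurd ht ha.2.2
  have h3 := (card_le_card hcover).trans (card_union_le _ _)
  rw [card_product] at h3
  omega

theorem IsUnitrade.isClassified_of_support_card_eq_eight {U : Finset (Finset V)}
    (hU : IsUnitrade 5 U) (h : U.card = 16) (hT : (support U).card = 8) : IsClassified U := by
  obtain ⟨B, hB⟩ : U.Nonempty := card_pos.1 (by omega)
  have hBc := hU.1 B hB
  have hBT := subset_support hB
  have hex : ∀ z ∈ B, ∃ t, t ∉ B ∧ t ∉ B.erase z ∧ insert t (B.erase z) ∈ U := fun z hz =>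
    hU.exists_neighbor hB (erase_subset _ _) (by rw [card_erase_of_mem hz]; omega)
  choose! f hf1 _ hf2 using hex
  -- Two of the five neighbours of `B` use the same point `y` among the three points outside `B`.
  obtain ⟨y, hy, hy2⟩ := exists_lt_card_fiber_of_mul_lt_card_of_maps_to (s := B)
    (t := support U \ B) (f := f) (n := 1)
    (fun z hz => mem_sdiff.2 ⟨subset_support (hf2 z hz) (mem_insert_self _ _), hf1 z hz⟩)
    (by rw [card_sdiff_of_subset hBT]; omega)
  rw [mem_sdiff] at hy
  have hHc : (insert y B).card = 6 := by rw [card_insert_of_notMem hy.2, hBc]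
  have hHT : insert y B ⊆ support U := insert_subset hy.1 hBT
  have hsub : insert y (B.filter (f · = y)) ⊆
      (insert y B).filter ((insert y B).erase · ∈ U) := by
    refine insert_subset ?_ fun z hz => ?_
    · rw [mem_filter, erase_insert hy.2]
      exact ⟨mem_insert_self _ _, hB⟩
    · rw [mem_filter] at hz
      refine mem_filter.2 ⟨mem_insert_of_mem hz.1, ?_⟩
      rw [erase_insert_of_ne (by rintro rfl; exact hy.2 hz.1), ← hz.2]
      exact hf2 z hz.1
  have hN3 := card_le_card hsub
  rw [card_insert_of_notMem (fun h => hy.2 (mem_filter.1 h).1)] at hN3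
  generalize insert y B = H at *
  have hNM := card_filter_add_card_filter_not (s := H) (fun z => H.erase z ∈ U)
  by_cases h6 : (H.filter (H.erase · ∈ U)).card = 6
  · refine hU.isClassified_of_simplexBoundary_subset h hHc fun u hu => ?_
    obtain ⟨z, hz, rfl⟩ := mem_simplexBoundary.1 hu
    have := eq_of_subset_of_card_le (filter_subset (H.erase · ∈ U) H) (by omega)
    rw [← this] at hz
    exact (mem_filter.1 hz).2
  · have hcompl : (support U \ H).card = 2 := by rw [card_sdiff_of_subset hHT]; omega
    obtain ⟨v, x, hvx, hvxe⟩ := card_eq_two.1 hcompl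
    have hv : v ∈ support U \ H := by simp [hvxe]
    have hx : x ∈ support U \ H := by simp [hvxe]
    rw [mem_sdiff] at hv hx
    have hsupp : support U ⊆ insert v (insert x H) := by
      intro t ht
      by_cases htH : t ∈ H
      · exact mem_insert_of_mem (mem_insert_of_mem htH)
      · have : t ∈ support U \ H := mem_sdiff.2 ⟨ht, htH⟩
        rw [hvxe, mem_insert, mem_singleton] at this
        rcases this with rfl | rfl <;> simp
    have hdeg := hU.blockDegree_add_le hHc hv.2 hx.2 hvx hsupp
    generalize (H.filter (H.erase · ∈ U)).card = d at *
    generalize (H.filter (H.erase · ∉ U)).card = e at *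
    have hde : 15 ≤ 2 * d + d * e := by
      obtain rfl : e = 6 - d := by omega
      have : d = 3 ∨ d = 4 ∨ d = 5 := by omega
      rcases this with rfl | rfl | rfl <;> norm_num
    rcases le_or_gt (blockDegree v U) 8 with h8 | h8
    · exact hU.isClassified_of_blockDegree_le h hv.1 h8
    · exact hU.isClassified_of_blockDegree_le h hx.1 (by omega)

theorem IsUnitrade.isClassified {U : Finset (Finset V)} (hU : IsUnitrade 5 U)
    (h : U.card = 16) : IsClassified U := by
  have h7 := hU.card_le_twelve
  by_cases h8 : (support U).card = 8
  · exact hU.isClassified_of_support_card_eq_eight h h8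
  · obtain ⟨v, hv, hle⟩ := hU.exists_blockDegree_le (m := 8) (by omega)
    exact hU.isClassified_of_blockDegree_le h hv hle

/-! ### Relabelled copies of the standard unitrades -/

theorem relabel_simplexBoundary {V₁ : Type*} [DecidableEq V₁] (f : V₁ ↪ V) (T : Finset V₁) :
    relabel f (simplexBoundary T) = simplexBoundary (T.map f) := by
  ext u
  simp only [relabel, mem_map, mem_simplexBoundary, RelEmbedding.coe_toEmbedding,
    mapEmbedding_apply]
  constructor
  · rintro ⟨_, ⟨x, hx, rfl⟩, rfl⟩
    exact ⟨f x, ⟨x, hx, rfl⟩, (map_erase f T x).symm⟩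
  · rintro ⟨_, ⟨x, hx, rfl⟩, rfl⟩
    exact ⟨_, ⟨x, hx, rfl⟩, map_erase f T x⟩

theorem relabel_symmDiff {V₁ : Type*} [DecidableEq V₁] (f : V₁ ↪ V) (U X : Finset (Finset V₁)) :
    relabel f (symmDiff U X) = symmDiff (relabel f U) (relabel f X) := by
  simp only [relabel, map_eq_image]
  exact image_symmDiff U X (mapEmbedding f).injective

theorem isUnitrade_relabel_simplexBoundary {n : ℕ} (f : Fin n ↪ V) {T : Finset (Fin n)}
    (hT : T.card = 6) : IsUnitrade 5 (relabel f (simplexBoundary T)) := by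
  rw [relabel_simplexBoundary]
  exact isUnitrade_simplexBoundary (by rw [card_map, hT])

theorem unitradeW_eq (k : ℕ) : unitradeW k = simplexBoundary univ := rfl

theorem unitradeR5_eq : unitradeR5 =
    symmDiff (simplexBoundary (insert 5 {0, 1, 2, 3, 4}))
      (simplexBoundary (insert 6 {0, 1, 2, 3, 4})) := by decide +kernel

theorem unitradeE_eq : unitradeE =
    symmDiff (symmDiff (simplexBoundary (insert 5 (insert 6 (insert 0 {1, 2, 3}))))
      (symmDiff (simplexBoundary (insert 5 (insert 4 (insert 0 {1, 2, 3}))))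
        (simplexBoundary (insert 6 (insert 4 (insert 0 {1, 2, 3}))))))
      (simplexBoundary (insert 7 (insert 5 (insert 6 {1, 2, 3})))) := by decide +kernel

theorem unitradeF_eq : unitradeF =
    symmDiff (symmDiff (simplexBoundary (insert 4 (insert 6 {0, 1, 2, 3})))
        (simplexBoundary (insert 5 (insert 6 {0, 1, 2, 3}))))
      (symmDiff (simplexBoundary (insert 4 (insert 7 {0, 1, 2, 3})))
        (simplexBoundary (insert 5 (insert 7 {0, 1, 2, 3})))) := by decide +kernel

theorem equivTo_unitradeW_iff {k : ℕ} {U : Finset (Finset V)} :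
    EquivTo (unitradeW k) U ↔ ∃ T : Finset V, T.card = k + 1 ∧ U = simplexBoundary T := by
  constructor
  · rintro ⟨f, rfl⟩
    exact ⟨univ.map f, by simp, by rw [unitradeW_eq, relabel_simplexBoundary]⟩
  · rintro ⟨T, hT, rfl⟩
    refine ⟨(T.equivFinOfCardEq hT).symm.toEmbedding.trans (Function.Embedding.subtype _), ?_⟩
    rw [unitradeW_eq, relabel_simplexBoundary]
    congr 1
    ext x
    simp only [mem_map, mem_univ, true_and]
    constructor
    · intro hx
      exact ⟨T.equivFinOfCardEq hT ⟨x, hx⟩, by simp⟩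
    · rintro ⟨i, rfl⟩
      exact ((T.equivFinOfCardEq hT).symm i).2

theorem equivTo_unitradeR5_iff {U : Finset (Finset V)} :
    EquivTo unitradeR5 U ↔ IsSuspension 5 U := by
  constructor
  · rintro ⟨f, rfl⟩
    refine ⟨({0, 1, 2, 3, 4} : Finset (Fin 7)).map f, f 5, f 6, by rw [card_map]; rfl,
      by simp, by simp, by simp, ?_⟩
    rw [unitradeR5_eq, relabel_symmDiff, relabel_simplexBoundary, relabel_simplexBoundary,
      map_insert f 5, map_insert f 6]
  · rintro ⟨B, p, q, hB, hp, hq, hpq, rfl⟩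
    obtain ⟨a, B₁, ha, rfl, hB₁⟩ := card_eq_succ.1 hB
    obtain ⟨b, B₂, hb, rfl, hB₂⟩ := card_eq_succ.1 hB₁
    obtain ⟨c, d, e, hcd, hce, hde, rfl⟩ := card_eq_three.1 hB₂
    have hinj : Function.Injective ![a, b, c, d, e, p, q] :=
      List.nodup_ofFn.1 (by simp [List.ofFn_succ] at *; grind)
    refine ⟨⟨_, hinj⟩, ?_⟩
    rw [unitradeR5_eq, relabel_symmDiff, relabel_simplexBoundary, relabel_simplexBoundary]
    simp [map_insert]

theorem IsStackedTriangleJoin.equivTo {U : Finset (Finset V)} (hU : IsStackedTriangleJoin U) :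
    EquivTo unitradeE U := by
  obtain ⟨C, c, x, y, z, v, hC, hc, hx, hy, hz, hxy, hxz, hyz, hv, hvx, hvy, hvz, rfl⟩ := hU
  obtain ⟨a, b, d, hab, had, hbd, rfl⟩ := card_eq_three.1 hC
  have hinj : Function.Injective ![c, a, b, d, z, x, y, v] :=
    List.nodup_ofFn.1 (by simp [List.ofFn_succ] at *; grind)
  refine ⟨⟨_, hinj⟩, ?_⟩
  simp only [unitradeE_eq, relabel_symmDiff, relabel_simplexBoundary]
  simp [map_insert]

theorem IsSquareJoin.equivTo {U : Finset (Finset V)} (hU : IsSquareJoin U) :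
    EquivTo unitradeF U := by
  obtain ⟨Q, p, q, x, y, hQ, hp, hq, hx, hy, hpq, hpx, hpy, hqx, hqy, hxy, rfl⟩ := hU
  obtain ⟨a, Q₁, ha, rfl, hQ₁⟩ := card_eq_succ.1 hQ
  obtain ⟨b, c, d, hbc, hbd, hcd, rfl⟩ := card_eq_three.1 hQ₁
  have hinj : Function.Injective ![a, b, c, d, p, q, x, y] :=
    List.nodup_ofFn.1 (by simp [List.ofFn_succ] at *; grind)
  refine ⟨⟨_, hinj⟩, ?_⟩
  simp only [unitradeF_eq, relabel_symmDiff, relabel_simplexBoundary]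
  simp [map_insert]

theorem EquivTo.unitradeE_isUnitrade {U : Finset (Finset V)} (h : EquivTo unitradeE U) :
    IsUnitrade 5 U ∧ U.card = 16 := by
  obtain ⟨f, rfl⟩ := h
  refine ⟨?_, by rw [relabel, card_map]; decide +kernel⟩
  simp only [unitradeE_eq, relabel_symmDiff]
  refine isUnitrade_symmDiff (isUnitrade_symmDiff ?_ (isUnitrade_symmDiff ?_ ?_)) ?_ <;>
    exact isUnitrade_relabel_simplexBoundary f (by decide)

theorem EquivTo.unitradeF_isUnitrade {U : Finset (Finset V)} (h : EquivTo unitradeF U) :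
    IsUnitrade 5 U ∧ U.card = 16 := by
  obtain ⟨f, rfl⟩ := h
  refine ⟨?_, by rw [relabel, card_map]; decide +kernel⟩
  simp only [unitradeF_eq, relabel_symmDiff]
  refine isUnitrade_symmDiff (isUnitrade_symmDiff ?_ ?_) (isUnitrade_symmDiff ?_ ?_) <;>
    exact isUnitrade_relabel_simplexBoundary f (by decide)

theorem IsBoundaryUnionSuspension.isUnitrade {U : Finset (Finset V)}
    (h : IsBoundaryUnionSuspension U) : IsUnitrade 5 U ∧ U.card = 16 := by
  obtain ⟨T, R, hT, ⟨B, p, q, hB, hp, hq, hpq, rfl⟩, hd, rfl⟩ := h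
  constructor
  · rw [← sup_eq_union, ← hd.symmDiff_eq_sup]
    exact isUnitrade_symmDiff (isUnitrade_simplexBoundary hT) (isUnitrade_suspension hB hp hq)
  · rw [card_union_of_disjoint hd, card_simplexBoundary, card_suspension hp hq hpq, hT, hB]

end

theorem theorem1 :
    (∃ W : Finset (Finset (Fin 8)), EquivTo (unitradeW 5) W ∧
      unitradeE = symmDiff (relabel Fin.castSuccEmb unitradeS) W) ∧
    (∃ S₁ S₂ : Finset (Finset (Fin 8)), EquivTo unitradeS S₁ ∧ EquivTo unitradeS S₂ ∧
      unitradeF = symmDiff S₁ S₂) ∧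
    ∀ (V : Type*) [DecidableEq V] (U : Finset (Finset V)),
      (IsUnitrade 5 U ∧ U.card = 16) ↔
        (∃ W R : Finset (Finset V), EquivTo (unitradeW 5) W ∧ EquivTo unitradeR5 R ∧
          Disjoint W R ∧ U = W ∪ R) ∨
        EquivTo unitradeE U ∨ EquivTo unitradeF U := by
  refine ⟨⟨simplexBoundary {1, 2, 3, 5, 6, 7}, equivTo_unitradeW_iff.2 ⟨_, by decide, rfl⟩,
    by decide +kernel⟩, ⟨relabel Fin.castSuccEmb unitradeS,
    relabel ⟨![0, 1, 2, 3, 4, 5, 7], by decide⟩ unitradeS, ⟨_, rfl⟩, ⟨_, rfl⟩,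
    by decide +kernel⟩, fun V _ U => ⟨?_, ?_⟩⟩
  · rintro ⟨hU, h⟩
    rcases hU.isClassified h with ⟨T, R, hT, hR, hd, rfl⟩ | hE | hF
    · exact Or.inl ⟨_, R, equivTo_unitradeW_iff.2 ⟨T, hT, rfl⟩, equivTo_unitradeR5_iff.2 hR, hd,
        rfl⟩
    · exact Or.inr (Or.inl hE.equivTo)
    · exact Or.inr (Or.inr hF.equivTo)
  · rintro (⟨W, R, hW, hR, hd, rfl⟩ | hE | hF)
    · obtain ⟨T, hT, rfl⟩ := equivTo_unitradeW_iff.1 hW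
      exact IsBoundaryUnionSuspension.isUnitrade
        ⟨T, R, hT, equivTo_unitradeR5_iff.1 hR, hd, rfl⟩
    · exact hE.unitradeE_isUnitrade
    · exact hF.unitradeF_isUnitrade
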